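/- Model. There are $n\ge 1$ actions and $m$ outcomes, and a reward vector $r\in[0,1]^m$. An agent type is $\theta=(f,c)$, where $f_1,\dots,f_n$ are probability distributions on the $m$ outcomes and $c\in[0,\infty)^n$ is a cost vector with $c_1=0$. Under a contract $t\in\mathbb R^m$ the agent takes an action $i^*(\theta,t)$ that maximizes $\sum_j f_{i,j}t_j-c_i$, with ties broken in favor of the principal, that is, so as to maximize $\sum_j f_{i,j}(r_j-t_j)$; the principal's utility is $u_p(\theta,t)=\sum_j f_{i^*(\theta,t),j}(r_j-t_j)$. For a probability distribution $\mathcal D$ on types let $U_p(\mathcal D,t)=\mathbb E_{\theta\sim\mathcal D}[u_p(\theta,t)]$, and for a sample $S=(\theta_1,\dots,\theta_s)$ let $u_p(S,t)=\frac1s\sum_{i=1}^s u_p(\theta_i,t)$. The linear contracts are $\mathcal C_{\mathrm{linear}}=\{\alpha r:\alpha\in[0,1]\}$, and $\alpha$ is written for $\alpha r$. The empirical utility maximization (EUM) algorithm has access to the sample $S$ only through an oracle for $u_p(S,\cdot)$; it queries the oracle at the linear contracts with parameters in the grid $G_\varepsilon=\{0,\varepsilon/4,2\varepsilon/4,\dots,\lfloor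 4/\varepsilon\rfloor\varepsilon/4,1\}\subseteq[0,1]$ and returns some $\hat\alpha\in\arg\max_{\alpha\in G_\varepsilon}u_p(S,\alpha)$, with ties broken arbitrarily. Corollary (EUM Optimal Sample Complexity). Let $\mathcal D$ be any probability distribution on agent types, $r\in[0,1]^m$, $\varepsilon>0$ and $\delta\in(0,1)$. If $s\ge 6912\ln(4/\delta)/\varepsilon^2$, then with probability at least $1-\delta$ over $S\sim\mathcal D^s$ the EUM algorithm returns a contract $\hat\alpha\in\mathcal C_{\mathrm{linear}}$ with $$U_p(\mathcal D,\hat\alpha)\ \ge\ \sup_{\alpha\in\mathcal C_{\mathrm{linear}}}U_p(\mathcal D,\alpha)-\varepsilon .$$ Moreover, for every sample the algorithm asks $O(1/\varepsilon)$ oracle queries: at most $4/\varepsilon+2$ for every $\varepsilon>0$, hence at most $6/\varepsilon$ when $\varepsilon\le1$. -/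

import Mathlib

open MeasureTheory

namespace LinearContracts

/-- The private type of an agent with actions `Fin n` (action `0` is the outside option) and
outcomes `Fin m`: a production function, each row of which is a probability distribution over
the outcomes, and a nonnegative cost vector. -/
@[ext] structure AgentType (n m : ℕ) [NeZero n] where
  /-- `prod i j` is the probability of outcome `j` under action `i`. -/
  prod : Fin n → Fin m → ℝ
  /-- `cost i` is the cost of action `i`. -/
  cost : Fin n → ℝ
  prod_nonneg : ∀ i j, 0 ≤ prod i j
  prod_sum : ∀ i, ∑ j, prod i j = 1
  cost_nonneg : ∀ i, 0 ≤ cost i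
  cost_zero : cost 0 = 0

/-- The Borel σ-algebra of the space of types, as a subset of `ℝ^(n×m) × ℝ^n`. -/
instance instMeasurableSpaceAgentType (n m : ℕ) [NeZero n] : MeasurableSpace (AgentType n m) :=
  MeasurableSpace.comap (fun θ => (θ.prod, θ.cost)) inferInstance

section Model

variable {n m : ℕ} [NeZero n]

/-- Expected utility of the agent `θ` under the contract `t` when taking action `i`. -/
def agentUtility (θ : AgentType n m) (t : Fin m → ℝ) (i : Fin n) : ℝ :=
  ∑ j, θ.prod i j * t j - θ.cost i

/-- Expected payoff of the principal if the agent `θ` takes action `i` under the contract `t`. -/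
def actionPayoff (r : Fin m → ℝ) (θ : AgentType n m) (t : Fin m → ℝ) (i : Fin n) : ℝ :=
  ∑ j, θ.prod i j * (r j - t j)

/-- Action `i` maximizes the agent's utility. -/
def IsBestResponse (θ : AgentType n m) (t : Fin m → ℝ) (i : Fin n) : Prop :=
  ∀ k, agentUtility θ t k ≤ agentUtility θ t i

/-- Action `i` maximizes the agent's utility, with ties broken in the principal's favor. -/
def IsChosenAction (r : Fin m → ℝ) (θ : AgentType n m) (t : Fin m → ℝ) (i : Fin n) : Prop :=
  IsBestResponse θ t i ∧ ∀ k, IsBestResponse θ t k → actionPayoff r θ t k ≤ actionPayoff r θ t i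

theorem exists_isChosenAction (r : Fin m → ℝ) (θ : AgentType n m) (t : Fin m → ℝ) :
    ∃ i, IsChosenAction r θ t i := by
  classical
  obtain ⟨i₀, -, h₀⟩ := Finset.exists_max_image Finset.univ (agentUtility θ t)
    Finset.univ_nonempty
  obtain ⟨i, hi, h⟩ := Finset.exists_max_image
    (Finset.univ.filter (fun i => IsBestResponse θ t i)) (actionPayoff r θ t)
    ⟨i₀, Finset.mem_filter.mpr ⟨Finset.mem_univ _, fun k => h₀ k (Finset.mem_univ _)⟩⟩
  exact ⟨i, (Finset.mem_filter.mp hi).2, fun k hk => h k (by simpa using hk)⟩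

/-- The action `i*(θ, t)` taken by the agent. -/
noncomputable def chosenAction (r : Fin m → ℝ) (θ : AgentType n m) (t : Fin m → ℝ) : Fin n :=
  Classical.choose (exists_isChosenAction r θ t)

/-- The principal's utility `u_p(θ, t)`. -/
noncomputable def principalUtility (r : Fin m → ℝ) (θ : AgentType n m) (t : Fin m → ℝ) : ℝ :=
  actionPayoff r θ t (chosenAction r θ t)

/-- The expected utility `U_p(D, t)`. -/
noncomputable def expectedUtility (r : Fin m → ℝ) (D : Measure (AgentType n m))
    (t : Fin m → ℝ) : ℝ :=
  ∫ θ, principalUtility r θ t ∂D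

/-- The empirical utility `u_p(S, t)` on a sample `S` of size `s`. -/
noncomputable def empiricalUtility (r : Fin m → ℝ) {s : ℕ} (S : Fin s → AgentType n m)
    (t : Fin m → ℝ) : ℝ :=
  (1 / (s : ℝ)) * ∑ i, principalUtility r (S i) t

end Model

/-- The class of linear contracts `α r`, `α ∈ [0,1]`. -/
def linearContracts {m : ℕ} (r : Fin m → ℝ) : Set (Fin m → ℝ) :=
  {t | ∃ α ∈ Set.Icc (0 : ℝ) 1, t = α • r}

/-- Deterministic algorithms that interact with an oracle: either stop with an answer, or ask a
query and continue depending on the reply. -/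
inductive OracleAlg (Q R A : Type) : Type
  | done (a : A) : OracleAlg Q R A
  | ask (q : Q) (next : R → OracleAlg Q R A) : OracleAlg Q R A

namespace OracleAlg

variable {Q R A : Type}

/-- The answer of the algorithm when run with the oracle `O`. -/
def output (O : Q → R) : OracleAlg Q R A → A
  | done a => a
  | ask q next => output O (next (O q))

/-- The number of queries asked by the algorithm when run with the oracle `O`. -/
def queries (O : Q → R) : OracleAlg Q R A → ℕ
  | done _ => 0
  | ask q next => queries O (next (O q)) + 1

end OracleAlg

/-- The grid `0, ε/4, 2(ε/4), …, ⌊4/ε⌋(ε/4), 1`. -/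
noncomputable def grid (ε : ℝ) : List ℝ :=
  (List.range (⌊4 / ε⌋₊ + 1)).map (fun k : ℕ => (k : ℝ) * (ε / 4)) ++ [1]

/-- `pick` is a rule that selects, from every nonempty list of pairs (point, value), a point of
largest value; ties may be broken in any way. -/
def IsArgmaxRule (pick : List (ℝ × ℝ) → ℝ) : Prop :=
  ∀ L : List (ℝ × ℝ), L ≠ [] → ∃ v, (pick L, v) ∈ L ∧ ∀ p ∈ L, p.2 ≤ v

theorem exists_isArgmaxRule : ∃ pick, IsArgmaxRule pick := by
  have h : ∀ L : List (ℝ × ℝ), ∃ a : ℝ, L ≠ [] → ∃ v, (a, v) ∈ L ∧ ∀ p ∈ L, p.2 ≤ v := by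
    intro L
    by_cases hL : L = []
    · exact ⟨0, fun h => absurd hL h⟩
    · obtain ⟨p, hp, hmax⟩ := Finset.exists_max_image L.toFinset Prod.snd
        (List.toFinset_nonempty_iff L |>.mpr hL)
      exact ⟨p.1, fun _ => ⟨p.2, by simpa using hp, fun q hq => hmax q (by simpa using hq)⟩⟩
  choose pick hpick using h
  exact ⟨pick, hpick⟩

/-- Query the oracle at the linear contract `α r` for each `α` of a list, recording the replies,
and finally return the point that `pick` selects. -/
def queryAll {m : ℕ} (r : Fin m → ℝ) (pick : List (ℝ × ℝ) → ℝ) :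
    List ℝ → List (ℝ × ℝ) → OracleAlg (Fin m → ℝ) ℝ ℝ
  | [], record => .done (pick record)
  | α :: rest, record => .ask (α • r) fun v => queryAll r pick rest (record ++ [(α, v)])

/-- Empirical utility maximization for linear contracts: query the oracle on the grid and return
a parameter `α` of largest reply. The algorithm sees only `r`, `ε` and the oracle. -/
noncomputable def eum {m : ℕ} (r : Fin m → ℝ) (ε : ℝ) (pick : List (ℝ × ℝ) → ℝ) :
    OracleAlg (Fin m → ℝ) ℝ ℝ :=
  queryAll r pick (grid ε) []

end LinearContracts

namespace LinearContracts

/-! Under the contract `α • r` the principal earns `(1 - α) * linearReward r α θ`, and for each type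
this reward lies in `[0,1]` and increases with `α`. An increasing family satisfies a uniform
deviation bound with no dependence on the number of its members, so the grid size does not enter the
sample bound.

That bound, `measureReal_exists_deviation_le`, comes from symmetrization with a ghost sample, which
leaves the exponential moment of a supremum of Rademacher sums along an increasing path in the unit
cube. Writing each coordinate as an integral of threshold indicators turns the path into chains of
subsets (`sum_exp_sup_le_of_monotone`). Along a chain the sums are partial sums of one ordered sign
sequence, and Doob's L² maximal inequality costs only a factor `4` (`exists_maximal_function`).

Optimality needs two one-sided events, each with tolerance `3ε/8`: no grid point is overestimated,
and one fixed best grid point is not underestimated. Rounding a contract up to the grid loses at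
most `ε/4`, since the reward does not fall (`principalUtility_le_add`). The three losses add up to
`ε`. -/

/-! ### Preliminaries on signs, threshold indicators and Jensen's inequality. -/

theorem flip_sign_self {ι : Type*} [DecidableEq ι] (i : ι) (σ : ι → ℤˣ) :
    ((((σ * Pi.mulSingle i (-1 : ℤˣ) : ι → ℤˣ) i : ℤˣ) : ℤ) : ℝ) = -((σ i : ℤ) : ℝ) := by
  simp

theorem flip_sign_of_ne {ι : Type*} [DecidableEq ι] {i j : ι} (h : j ≠ i) (σ : ι → ℤˣ) :
    (σ * Pi.mulSingle i (-1 : ℤˣ) : ι → ℤˣ) j = σ j := by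
  simp [Pi.mulSingle_eq_of_ne h]

theorem abs_sum_sign_mul_le {ι : Type*} [Fintype ι] (σ : ι → ℤˣ) (y : ι → ℝ) (hy : ∀ i, |y i| ≤ 1) :
    |∑ i, ((σ i : ℤ) : ℝ) * y i| ≤ Fintype.card ι := by
  refine (Finset.abs_sum_le_sum_abs _ _).trans ?_
  have : ∀ i ∈ Finset.univ, |((σ i : ℤ) : ℝ) * y i| ≤ 1 := fun i _ => by
    rcases Int.units_eq_one_or (σ i) with h | h <;> simpa [h] using hy i
  simpa using Finset.sum_le_sum this

theorem integral_indicator_lt {y : ℝ} (hy : y ∈ Set.Icc (0 : ℝ) 1) :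
    ∫ x in Set.Ioc (0 : ℝ) 1, (if x < y then (1 : ℝ) else 0) = y := by
  have h : (fun x : ℝ => if x < y then (1 : ℝ) else 0) = (Set.Iio y).indicator 1 := by
    ext x; simp [Set.indicator_apply]
  rw [h, integral_indicator_one measurableSet_Iio, measureReal_def,
    Measure.restrict_apply measurableSet_Iio]
  have h2 : Set.Iio y ∩ Set.Ioc 0 1 = Set.Ioo 0 y := by
    ext x
    simp only [Set.mem_inter_iff, Set.mem_Iio, Set.mem_Ioc, Set.mem_Ioo]
    exact ⟨fun h => ⟨h.2.1, h.1⟩, fun h => ⟨h.2, h.1, h.2.le.trans hy.2⟩⟩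
  rw [h2]
  simp [hy.1]

theorem integrable_of_mem_Icc {Ω : Type*} [MeasurableSpace Ω] {P : Measure Ω} [IsFiniteMeasure P]
    {f : Ω → ℝ} (hf : Measurable f) (a b : ℝ) (h : ∀ x, f x ∈ Set.Icc a b) : Integrable f P :=
  Integrable.of_mem_Icc a b hf.aemeasurable (Filter.Eventually.of_forall h)

theorem exp_integral_le {Ω : Type*} [MeasurableSpace Ω] {P : Measure Ω} [IsProbabilityMeasure P]
    {f : Ω → ℝ} (hf : Measurable f) (C : ℝ) (h : ∀ x, |f x| ≤ C) :
    Real.exp (∫ x, f x ∂P) ≤ ∫ x, Real.exp (f x) ∂P :=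
  convexOn_exp.map_integral_le Real.continuous_exp.continuousOn isClosed_univ (by simp)
    (integrable_of_mem_Icc hf (-C) C fun x => abs_le.mp (h x))
    (integrable_of_mem_Icc hf.exp 0 (Real.exp C) fun x =>
      ⟨(Real.exp_pos _).le, Real.exp_le_exp.mpr (abs_le.mp (h x)).2⟩)

/-! ### Maximal inequalities for Rademacher sums. -/

section Signs

variable {ι : Type*} [Fintype ι] [DecidableEq ι]

theorem sum_flip_sign (i : ι) (F : (ι → ℤˣ) → ℝ) :
    ∑ σ : ι → ℤˣ, F (σ * Pi.mulSingle i (-1)) = ∑ σ, F σ :=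
  Fintype.sum_equiv (Equiv.mulRight (Pi.mulSingle i (-1))) _ _ fun _ => rfl

theorem sum_exp_signs_le (b : ℝ) :
    ∑ σ : ι → ℤˣ, Real.exp (∑ i, b * ((σ i : ℤ) : ℝ)) ≤
      2 ^ Fintype.card ι * Real.exp (Fintype.card ι * (b ^ 2 / 2)) := by
  have h : ∑ σ : ι → ℤˣ, Real.exp (∑ i, b * ((σ i : ℤ) : ℝ)) = (2 * Real.cosh b) ^ Fintype.card ι := by
    have := Finset.prod_univ_sum (fun _ : ι => (Finset.univ : Finset ℤˣ))
      (fun _ u => Real.exp (b * ((u : ℤ) : ℝ)))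
    rw [Fintype.piFinset_univ] at this
    simp_rw [Real.exp_sum]
    rw [← this]
    have h2 : ∑ u : ℤˣ, Real.exp (b * ((u : ℤ) : ℝ)) = 2 * Real.cosh b := by
      rw [Real.cosh_eq, mul_div_cancel₀ _ two_ne_zero]
      simp
    rw [Finset.prod_congr rfl fun _ _ => h2, Finset.prod_const, Finset.card_univ]
  rw [h, mul_pow, Real.exp_nat_mul]
  gcongr
  exact Real.cosh_le_exp_half_sq b

/-- A Doob-type maximal function for exponentials of signed sums, adding the indices in the order
of increasing `ρ`. -/
theorem exists_maximal_function (ρ : ι → ℕ) (a : ℝ) (I : Finset ι) :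
    ∃ M : (ι → ℤˣ) → ℝ,
      (∀ i ∉ I, ∀ σ, M (σ * Pi.mulSingle i (-1)) = M σ) ∧
      (∀ σ τ, Real.exp (∑ i ∈ I with ρ i ≤ τ, a * ((σ i : ℤ) : ℝ)) ≤ M σ) ∧
      ∑ σ, (M σ ^ 2 - 2 * M σ * Real.exp (∑ i ∈ I, a * ((σ i : ℤ) : ℝ))) ≤ 0 := by
  induction I using Finset.induction_on_max_value ρ with
  | empty => exact ⟨fun _ => 1, by simp, by simp, Finset.sum_nonpos fun σ _ => by norm_num⟩
  | insert i I hi hmax ih =>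
    obtain ⟨M, hinv, hle, hsum⟩ := ih
    set X : (ι → ℤˣ) → ℝ := fun σ => Real.exp (∑ i ∈ I, a * ((σ i : ℤ) : ℝ)) with hX
    have hXinv : ∀ j ∉ I, ∀ σ, X (σ * Pi.mulSingle j (-1)) = X σ := fun j hj σ => by
      simp only [hX]
      congr 1
      refine Finset.sum_congr rfl fun k hk => ?_
      rw [flip_sign_of_ne (ne_of_mem_of_not_mem hk hj)]
    have hX' : ∀ σ : ι → ℤˣ, Real.exp (∑ k ∈ insert i I, a * ((σ k : ℤ) : ℝ)) =
        X σ * Real.exp (a * ((σ i : ℤ) : ℝ)) := fun σ => by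
      rw [Finset.sum_insert hi, Real.exp_add, mul_comm]
    have hMpos : ∀ σ, 0 ≤ M σ := fun σ => (Real.exp_pos _).le.trans (hle σ 0)
    -- The running maximum of the partial exponentials. Since `i` has the largest `ρ`, a threshold
    -- that admits `i` admits all of `I`.
    refine ⟨fun σ => max (M σ) (X σ * Real.exp (a * ((σ i : ℤ) : ℝ))), ?_, ?_, ?_⟩
    · intro j hj σ
      rw [Finset.mem_insert, not_or] at hj
      simp only
      rw [hinv j hj.2, hXinv j hj.2, flip_sign_of_ne (Ne.symm hj.1)]
    · intro σ τ
      rw [Finset.filter_insert]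
      split_ifs with h
      · rw [Finset.filter_true_of_mem fun x hx => (hmax x hx).trans h, hX']
        exact le_max_right _ _
      · exact (hle σ τ).trans (le_max_left _ _)
    · simp_rw [hX']
      -- When the maximum jumps to `y`, the left side is `-y ^ 2`, and the claim is `0 ≤ (M - y) ^
      -- 2`.
      have h1 : ∀ σ : ι → ℤˣ, max (M σ) (X σ * Real.exp (a * ((σ i : ℤ) : ℝ))) ^ 2 -
          2 * max (M σ) (X σ * Real.exp (a * ((σ i : ℤ) : ℝ))) *
            (X σ * Real.exp (a * ((σ i : ℤ) : ℝ))) ≤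
          M σ ^ 2 - 2 * (M σ * X σ * Real.exp (a * ((σ i : ℤ) : ℝ))) := fun σ => by
        set y := X σ * Real.exp (a * ((σ i : ℤ) : ℝ)) with hy
        rcases max_cases (M σ) y with ⟨h, -⟩ | ⟨h, -⟩ <;> rw [h] <;>
          nlinarith [sq_nonneg (M σ - y)]
      refine (Finset.sum_le_sum fun σ _ => h1 σ).trans ?_
      have hsum' : ∑ σ, (M σ ^ 2 - 2 * (M σ * X σ)) ≤ 0 := by
        simp_rw [← mul_assoc]
        exact hsum
      have h2 := sum_flip_sign i fun σ : ι → ℤˣ => M σ * X σ * Real.exp (a * ((σ i : ℤ) : ℝ))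
      simp_rw [hinv i hi, hXinv i hi, flip_sign_self] at h2
      -- Submartingale step: `M * X` does not depend on the sign at `i`, and averaging the
      -- exponential over that sign gives a `cosh`, which is at least `1`.
      have h3 : ∑ σ, M σ * X σ ≤ ∑ σ : ι → ℤˣ, M σ * X σ * Real.exp (a * ((σ i : ℤ) : ℝ)) := by
        have h4 : ∑ σ : ι → ℤˣ, (2 * (M σ * X σ)) ≤
            ∑ σ : ι → ℤˣ, (M σ * X σ * Real.exp (a * -((σ i : ℤ) : ℝ)) +
              M σ * X σ * Real.exp (a * ((σ i : ℤ) : ℝ))) := by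
          refine Finset.sum_le_sum fun σ _ => ?_
          have h5 := Real.one_le_cosh (a * ((σ i : ℤ) : ℝ))
          rw [Real.cosh_eq] at h5
          rw [mul_neg]
          have h6 : 0 ≤ M σ * X σ := mul_nonneg (hMpos σ) (Real.exp_pos _).le
          nlinarith
        rw [Finset.sum_add_distrib, h2, ← Finset.mul_sum] at h4
        linarith
      rw [Finset.sum_sub_distrib, ← Finset.mul_sum] at hsum' ⊢
      linarith

theorem sum_exp_sup_le_of_threshold (ρ : ι → ℕ) (b : ℝ) {κ : Type*} [Fintype κ] [Nonempty κ]
    (τ : κ → ℕ) :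
    ∑ σ : ι → ℤˣ, Finset.univ.sup' Finset.univ_nonempty
        (fun k => Real.exp (b * ∑ i with ρ i ≤ τ k, ((σ i : ℤ) : ℝ))) ≤
      4 * (2 ^ Fintype.card ι * Real.exp (Fintype.card ι * (b ^ 2 / 2))) := by
  obtain ⟨M, -, hle, hsum⟩ := exists_maximal_function ρ (b / 2) (Finset.univ : Finset ι)
  calc _ ≤ ∑ σ : ι → ℤˣ, M σ ^ 2 := by
        refine Finset.sum_le_sum fun σ _ => Finset.sup'_le _ _ fun k _ => ?_
        have := pow_le_pow_left₀ (Real.exp_pos _).le (hle σ (τ k)) 2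
        rw [← Real.exp_nat_mul, ← Finset.mul_sum] at this
        convert this using 2
        push_cast
        ring
    _ ≤ ∑ σ : ι → ℤˣ, (4 * Real.exp (∑ i, b * ((σ i : ℤ) : ℝ)) +
          2 * (M σ ^ 2 - 2 * M σ * Real.exp (∑ i, b / 2 * ((σ i : ℤ) : ℝ)))) := by
        refine Finset.sum_le_sum fun σ _ => ?_
        have : Real.exp (∑ i, b * ((σ i : ℤ) : ℝ)) =
            Real.exp (∑ i, b / 2 * ((σ i : ℤ) : ℝ)) ^ 2 := by
          rw [← Real.exp_nat_mul, ← Finset.mul_sum, ← Finset.mul_sum]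
          congr 1
          push_cast
          ring
        rw [this]
        -- The difference of the two sides is exactly this square.
        nlinarith [sq_nonneg (M σ - 2 * Real.exp (∑ i, b / 2 * ((σ i : ℤ) : ℝ)))]
    _ ≤ _ := by
        rw [Finset.sum_add_distrib, ← Finset.mul_sum, ← Finset.mul_sum]
        have := sum_exp_signs_le (ι := ι) b
        linarith

/-- Rank `i` by the number of members of the chain that miss it. These form an initial segment of
`κ`, so membership in `B k` is a threshold condition on the rank. -/
theorem sum_exp_sup_le_of_chain {κ : Type*} [Fintype κ] [LinearOrder κ] [Nonempty κ]
    (B : κ → Finset ι) (hB : Monotone B) (b : ℝ) :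
    ∑ σ : ι → ℤˣ, Finset.univ.sup' Finset.univ_nonempty
        (fun k => Real.exp (b * ∑ i ∈ B k, ((σ i : ℤ) : ℝ))) ≤
      4 * (2 ^ Fintype.card ι * Real.exp (Fintype.card ι * (b ^ 2 / 2))) := by
  have key : ∀ k, B k = Finset.univ.filter fun i =>
      (Finset.univ.filter fun j => i ∉ B j).card ≤ (Finset.univ.filter fun j => j < k).card := by
    intro k
    ext i
    rw [Finset.mem_filter]
    refine ⟨fun hi => ⟨Finset.mem_univ _, Finset.card_le_card fun j hj => ?_⟩, fun ⟨_, h⟩ => ?_⟩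
    · simp only [Finset.mem_filter, Finset.mem_univ, true_and] at hj ⊢
      exact lt_of_not_ge fun hkj => hj (hB hkj hi)
    · by_contra hi
      refine absurd h (not_le.mpr (Finset.card_lt_card ?_))
      refine Finset.ssubset_iff_of_subset (fun j hj => ?_) |>.mpr ⟨k, by simpa using hi, by simp⟩
      simp only [Finset.mem_filter, Finset.mem_univ, true_and] at hj ⊢
      exact fun hij => hi (hB hj.le hij)
  have h := sum_exp_sup_le_of_threshold (fun i => (Finset.univ.filter fun j => i ∉ B j).card) b
    (fun k : κ => (Finset.univ.filter fun j => j < k).card)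
  simp_rw [← key] at h
  exact h

/-- The exponential moment of the supremum of a Rademacher sum over an increasing path in the
unit cube. -/
theorem sum_exp_sup_le_of_monotone {κ : Type*} [Fintype κ] [LinearOrder κ] [Nonempty κ]
    (g : κ → ι → ℝ) (hg : Monotone g) (hg01 : ∀ k i, g k i ∈ Set.Icc (0 : ℝ) 1) (b : ℝ) :
    ∑ σ : ι → ℤˣ, Finset.univ.sup' Finset.univ_nonempty
        (fun k => Real.exp (b * ∑ i, ((σ i : ℤ) : ℝ) * g k i)) ≤
      4 * (2 ^ Fintype.card ι * Real.exp (Fintype.card ι * (b ^ 2 / 2))) := by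
  -- Layer-cake: `g k i` is the mean of the indicator of `x < g k i` for `x` uniform on the unit
  -- interval. Jensen moves the exponential inside the integral, and for each fixed `x` the
  -- superlevel sets form a chain in `k`.
  set P : Measure ℝ := volume.restrict (Set.Ioc (0 : ℝ) 1) with hP
  have : IsProbabilityMeasure P := ⟨by simp [hP]⟩
  let f : κ → (ι → ℤˣ) → ℝ → ℝ := fun k σ x =>
    b * ∑ i, ((σ i : ℤ) : ℝ) * (if x < g k i then (1 : ℝ) else 0)
  have hfm : ∀ k σ, Measurable (f k σ) := fun k σ =>
    (Finset.measurable_sum _ fun i _ => (Measurable.ite measurableSet_Iio measurable_const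
      measurable_const).const_mul _).const_mul _
  have hfb : ∀ k σ x, |f k σ x| ≤ |b| * Fintype.card ι := fun k σ x => by
    rw [abs_mul]
    gcongr
    exact abs_sum_sign_mul_le σ _ fun i => by split_ifs <;> simp
  let H : (ι → ℤˣ) → ℝ → ℝ := fun σ =>
    Finset.univ.sup' Finset.univ_nonempty fun k x => Real.exp (f k σ x)
  have hHapp : ∀ σ x, H σ x = Finset.univ.sup' Finset.univ_nonempty
      fun k => Real.exp (f k σ x) := fun σ x => Finset.sup'_apply _ _ _
  have hle : ∀ k σ x, Real.exp (f k σ x) ≤ H σ x := fun k σ x => by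
    rw [hHapp]; exact Finset.le_sup' (fun k => Real.exp (f k σ x)) (Finset.mem_univ k)
  have hHm : ∀ σ, Measurable (H σ) := fun σ =>
    Finset.measurable_sup' _ fun k _ => (hfm k σ).exp
  obtain ⟨k₀⟩ := ‹Nonempty κ›
  have hHi : ∀ σ, Integrable (H σ) P := fun σ =>
    integrable_of_mem_Icc (hHm σ) 0 (Real.exp (|b| * Fintype.card ι)) fun x =>
      ⟨(Real.exp_pos _).le.trans (hle k₀ σ x), by
        rw [hHapp]
        exact Finset.sup'_le _ _ fun k _ =>
          Real.exp_le_exp.mpr (abs_le.mp (hfb k σ x)).2⟩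
  have hstep : ∀ σ, Finset.univ.sup' Finset.univ_nonempty
      (fun k => Real.exp (b * ∑ i, ((σ i : ℤ) : ℝ) * g k i)) ≤ ∫ x, H σ x ∂P := by
    intro σ
    refine Finset.sup'_le _ _ fun k _ => ?_
    have hint : ∫ x, f k σ x ∂P = b * ∑ i, ((σ i : ℤ) : ℝ) * g k i := by
      simp only [f]
      rw [integral_const_mul, integral_finsetSum]
      · congr 1
        refine Finset.sum_congr rfl fun i _ => ?_
        rw [integral_const_mul, hP, integral_indicator_lt (hg01 k i)]
      · intro i _
        refine Integrable.const_mul (integrable_of_mem_Icc (Measurable.ite measurableSet_Iio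
          measurable_const measurable_const) 0 1 fun x => ?_) _
        split_ifs <;> simp
    rw [← hint]
    refine (exp_integral_le (hfm k σ) _ (hfb k σ)).trans (integral_mono ?_ (hHi σ) (hle k σ))
    exact integrable_of_mem_Icc (hfm k σ).exp 0 (Real.exp (|b| * Fintype.card ι)) fun x =>
      ⟨(Real.exp_pos _).le, Real.exp_le_exp.mpr (abs_le.mp (hfb k σ x)).2⟩
  refine (Finset.sum_le_sum fun σ _ => hstep σ).trans ?_
  rw [← integral_finsetSum _ fun σ _ => hHi σ]
  have hpt : ∀ x, ∑ σ, H σ x ≤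
      4 * (2 ^ Fintype.card ι * Real.exp (Fintype.card ι * (b ^ 2 / 2))) := fun x => by
    have hB : Monotone fun k => Finset.univ.filter fun i => x < g k i := fun k l hkl i hi => by
      simp only [Finset.mem_filter, Finset.mem_univ, true_and] at hi ⊢
      exact hi.trans_le (hg hkl i)
    have h := sum_exp_sup_le_of_chain _ hB b
    simp_rw [hHapp]
    simpa only [f, mul_ite, mul_one, mul_zero, ← Finset.sum_filter] using h
  calc _ ≤ ∫ _, 4 * (2 ^ Fintype.card ι * Real.exp (Fintype.card ι * (b ^ 2 / 2))) ∂P :=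
        integral_mono (integrable_finsetSum _ fun σ _ => hHi σ) (integrable_const _) hpt
    _ = _ := by simp

/-- A difference of increasing paths need not be monotone; the inequality `exp (p - q) ≤ (exp (2p) +
exp (-2q)) / 2` separates the two paths at the price of doubling `b`. -/
theorem sum_exp_sup_sub_le_of_monotone {κ : Type*} [Fintype κ] [LinearOrder κ] [Nonempty κ]
    (g g' : κ → ι → ℝ) (hg : Monotone g) (hg' : Monotone g')
    (hg01 : ∀ k i, g k i ∈ Set.Icc (0 : ℝ) 1) (hg01' : ∀ k i, g' k i ∈ Set.Icc (0 : ℝ) 1) (b : ℝ) :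
    ∑ σ : ι → ℤˣ, Finset.univ.sup' Finset.univ_nonempty
        (fun k => Real.exp (b * ∑ i, ((σ i : ℤ) : ℝ) * (g k i - g' k i))) ≤
      4 * (2 ^ Fintype.card ι * Real.exp (Fintype.card ι * (2 * b ^ 2))) := by
  have h1 := sum_exp_sup_le_of_monotone g hg hg01 (2 * b)
  have h2 := sum_exp_sup_le_of_monotone g' hg' hg01' (-(2 * b))
  have h3 : ∀ σ : ι → ℤˣ, Finset.univ.sup' Finset.univ_nonempty
        (fun k => Real.exp (b * ∑ i, ((σ i : ℤ) : ℝ) * (g k i - g' k i))) ≤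
      (Finset.univ.sup' Finset.univ_nonempty
        (fun k => Real.exp (2 * b * ∑ i, ((σ i : ℤ) : ℝ) * g k i)) +
       Finset.univ.sup' Finset.univ_nonempty
        (fun k => Real.exp (-(2 * b) * ∑ i, ((σ i : ℤ) : ℝ) * g' k i))) / 2 := by
    intro σ
    refine Finset.sup'_le _ _ fun k _ => ?_
    have ha := Finset.le_sup' (fun k => Real.exp (2 * b * ∑ i, ((σ i : ℤ) : ℝ) * g k i))
      (Finset.mem_univ k)
    have hb := Finset.le_sup' (fun k => Real.exp (-(2 * b) * ∑ i, ((σ i : ℤ) : ℝ) * g' k i))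
      (Finset.mem_univ k)
    simp only [mul_sub, Finset.sum_sub_distrib, Real.exp_sub]
    set p := b * ∑ i, ((σ i : ℤ) : ℝ) * g k i with hp
    set q := b * ∑ i, ((σ i : ℤ) : ℝ) * g' k i with hq
    have e1 : 2 * b * ∑ i, ((σ i : ℤ) : ℝ) * g k i = p + p := by rw [hp]; ring
    have e2 : -(2 * b) * ∑ i, ((σ i : ℤ) : ℝ) * g' k i = -q + -q := by rw [hq]; ring
    rw [e1, Real.exp_add] at ha
    rw [e2, Real.exp_add] at hb
    rw [div_eq_mul_inv, ← Real.exp_neg]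
    nlinarith [sq_nonneg (Real.exp p - Real.exp (-q))]
  refine (Finset.sum_le_sum fun σ _ => h3 σ).trans ?_
  rw [← Finset.sum_div, Finset.sum_add_distrib]
  have e3 : (2 * b) ^ 2 / 2 = 2 * b ^ 2 := by ring
  have e4 : (-(2 * b)) ^ 2 / 2 = 2 * b ^ 2 := by ring
  rw [e3] at h1
  rw [e4] at h2
  linarith

end Signs

/-! ### Symmetrization and the uniform deviation bound. -/

/-- The largest exponential of a signed difference between a sample and a ghost sample. -/
noncomputable def signedSup {T ι κ : Type*} [Fintype ι] [Fintype κ] [Nonempty κ]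
    (g : κ → T → ℝ) (b : ℝ) (σ : ι → ℤˣ) (q : (ι → T) × (ι → T)) : ℝ :=
  Finset.univ.sup' Finset.univ_nonempty
    fun k => Real.exp (b * ∑ i, ((σ i : ℤ) : ℝ) * (g k (q.1 i) - g k (q.2 i)))

theorem le_signedSup {T ι κ : Type*} [Fintype ι] [Fintype κ] [Nonempty κ]
    (g : κ → T → ℝ) (b : ℝ) (σ : ι → ℤˣ) (q : (ι → T) × (ι → T)) (k : κ) :
    Real.exp (b * ∑ i, ((σ i : ℤ) : ℝ) * (g k (q.1 i) - g k (q.2 i))) ≤ signedSup g b σ q :=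
  Finset.le_sup' (fun k => Real.exp (b * ∑ i, ((σ i : ℤ) : ℝ) * (g k (q.1 i) - g k (q.2 i))))
    (Finset.mem_univ k)

theorem abs_signed_sum_le {T ι κ : Type*} [Fintype ι] {g : κ → T → ℝ}
    (hg01 : ∀ k θ, g k θ ∈ Set.Icc (0 : ℝ) 1)
    (b : ℝ) (σ : ι → ℤˣ) (q : (ι → T) × (ι → T)) (k : κ) :
    |b * ∑ i, ((σ i : ℤ) : ℝ) * (g k (q.1 i) - g k (q.2 i))| ≤ |b| * Fintype.card ι := by
  rw [abs_mul]
  gcongr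
  refine abs_sum_sign_mul_le σ _ fun i => abs_le.mpr ?_
  have h1 := hg01 k (q.1 i)
  have h2 := hg01 k (q.2 i)
  constructor <;> linarith [h1.1, h1.2, h2.1, h2.2]

theorem signedSup_mem_Icc {T ι κ : Type*} [Fintype ι] [Fintype κ] [Nonempty κ] {g : κ → T → ℝ}
    (hg01 : ∀ k θ, g k θ ∈ Set.Icc (0 : ℝ) 1)
    (b : ℝ) (σ : ι → ℤˣ) (q : (ι → T) × (ι → T)) :
    signedSup g b σ q ∈ Set.Icc 0 (Real.exp (|b| * Fintype.card ι)) :=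
  ⟨(Real.exp_pos _).le.trans (le_signedSup g b σ q (Classical.arbitrary κ)),
    Finset.sup'_le _ _ fun k _ =>
      Real.exp_le_exp.mpr (abs_le.mp (abs_signed_sum_le hg01 b σ q k)).2⟩

theorem measurable_signed_sum {T : Type*} [MeasurableSpace T] {ι κ : Type*} [Fintype ι] {g : κ → T → ℝ}
    (hgm : ∀ k, Measurable (g k)) (b : ℝ) (σ : ι → ℤˣ) (k : κ) :
    Measurable fun q : (ι → T) × (ι → T) =>
      b * ∑ i, ((σ i : ℤ) : ℝ) * (g k (q.1 i) - g k (q.2 i)) :=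
  (Finset.measurable_sum _ fun i _ =>
    (((hgm k).comp ((measurable_pi_apply i).comp measurable_fst)).sub
      ((hgm k).comp ((measurable_pi_apply i).comp measurable_snd))).const_mul _).const_mul _

section Symmetrization

variable {T : Type*} [MeasurableSpace T] {ι : Type*} [Fintype ι]
  {κ : Type*} [Fintype κ] {g : κ → T → ℝ}

theorem measurable_signedSup [Nonempty κ] (hgm : ∀ k, Measurable (g k)) (b : ℝ) (σ : ι → ℤˣ) :
    Measurable (signedSup g b σ) := by
  have h := Finset.measurable_sup' (Finset.univ_nonempty (α := κ))
    (f := fun k (q : (ι → T) × (ι → T)) =>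
      Real.exp (b * ∑ i, ((σ i : ℤ) : ℝ) * (g k (q.1 i) - g k (q.2 i))))
    fun k _ => (measurable_signed_sum hgm b σ k).exp
  convert h using 1
  ext q
  rw [Finset.sup'_apply]
  rfl

/-- Exchanging the coordinates of sample and ghost sample on which `σ` is negative. -/
def swapBy (σ : ι → ℤˣ) (p : ι → T × T) (i : ι) : T × T :=
  if σ i = 1 then p i else (p i).swap

theorem measurePreserving_swapBy (D : Measure T) [IsProbabilityMeasure D] (σ : ι → ℤˣ) :
    MeasurePreserving (swapBy σ) (Measure.pi fun _ : ι => D.prod D)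
      (Measure.pi fun _ : ι => D.prod D) := by
  refine measurePreserving_pi (f := fun i x => if σ i = 1 then x else x.swap)
    (fun _ : ι => D.prod D) (fun _ => D.prod D) fun i => ?_
  by_cases h : σ i = 1
  · simp only [h, if_true]
    exact MeasurePreserving.id _
  · simp only [h, if_false]
    exact Measure.measurePreserving_swap

/-- Negating the sign at `i` amounts to exchanging `S i` with its ghost copy, which preserves the
joint law. -/
theorem integral_signedSup [Nonempty κ] (hgm : ∀ k, Measurable (g k))
    (D : Measure T) [IsProbabilityMeasure D] (b : ℝ) (σ : ι → ℤˣ) :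
    ∫ q, signedSup g b σ q ∂((Measure.pi fun _ : ι => D).prod (Measure.pi fun _ : ι => D)) =
      ∫ q, signedSup g b (1 : ι → ℤˣ) q
        ∂((Measure.pi fun _ : ι => D).prod (Measure.pi fun _ : ι => D)) := by
  have hmp := measurePreserving_arrowProdEquivProdArrow T T ι (fun _ => D) (fun _ => D)
  rw [← hmp.integral_comp' , ← hmp.integral_comp']
  have hsw := measurePreserving_swapBy D σ
  have hm : Measurable fun p : ι → T × T =>
      signedSup g b (1 : ι → ℤˣ) (MeasurableEquiv.arrowProdEquivProdArrow T T ι p) :=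
    (measurable_signedSup hgm b 1).comp (MeasurableEquiv.measurable _)
  conv_rhs => rw [← hsw.map_eq]
  rw [integral_map hsw.measurable.aemeasurable hm.aestronglyMeasurable]
  refine integral_congr_ae (Filter.Eventually.of_forall fun p => ?_)
  simp only [signedSup]
  congr 1
  ext k
  congr 2
  refine Finset.sum_congr rfl fun i _ => ?_
  change ((σ i : ℤ) : ℝ) * (g k (p i).1 - g k (p i).2) =
    (((1 : ℤˣ) : ℤ) : ℝ) * (g k (swapBy σ p i).1 - g k (swapBy σ p i).2)
  rcases Int.units_eq_one_or (σ i) with h | h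
  · simp [swapBy, h]
  · have : (-1 : ℤˣ) ≠ 1 := by decide
    simp [swapBy, h, this]

/-- As the integral is the same for every sign vector, it equals its average over signs, which is
bounded for each fixed pair of samples. -/
theorem integral_signedSup_le [DecidableEq ι] [LinearOrder κ] [Nonempty κ]
    (hgm : ∀ k, Measurable (g k)) (hg : Monotone g)
    (hg01 : ∀ k θ, g k θ ∈ Set.Icc (0 : ℝ) 1) (D : Measure T) [IsProbabilityMeasure D] (b : ℝ) :
    ∫ q, signedSup g b (1 : ι → ℤˣ) q
        ∂((Measure.pi fun _ : ι => D).prod (Measure.pi fun _ : ι => D)) ≤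
      4 * Real.exp (Fintype.card ι * (2 * b ^ 2)) := by
  set Q := (Measure.pi fun _ : ι => D).prod (Measure.pi fun _ : ι => D)
  have hint : ∀ σ : ι → ℤˣ, Integrable (signedSup g b σ) Q := fun σ =>
    integrable_of_mem_Icc (measurable_signedSup hgm b σ) _ _ (signedSup_mem_Icc hg01 b σ)
  have h1 : ∑ σ : ι → ℤˣ, ∫ q, signedSup g b σ q ∂Q =
      2 ^ Fintype.card ι * ∫ q, signedSup g b (1 : ι → ℤˣ) q ∂Q := by
    rw [Finset.sum_congr rfl fun σ _ => integral_signedSup hgm D b σ]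
    simp [Q]
  have h2 : ∑ σ : ι → ℤˣ, ∫ q, signedSup g b σ q ∂Q ≤
      4 * (2 ^ Fintype.card ι * Real.exp (Fintype.card ι * (2 * b ^ 2))) := by
    rw [← integral_finsetSum _ fun σ _ => hint σ]
    calc _ ≤ ∫ _, 4 * (2 ^ Fintype.card ι * Real.exp (Fintype.card ι * (2 * b ^ 2))) ∂Q :=
          integral_mono (integrable_finsetSum _ fun σ _ => hint σ) (integrable_const _) fun q =>
            sum_exp_sup_sub_le_of_monotone (fun k i => g k (q.1 i)) (fun k i => g k (q.2 i))
              (fun k l h i => hg h _) (fun k l h i => hg h _) (fun _ _ => hg01 _ _)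
              (fun _ _ => hg01 _ _) b
      _ = _ := by simp
  rw [h1] at h2
  have h3 : (0 : ℝ) < 2 ^ Fintype.card ι := by positivity
  exact le_of_mul_le_mul_left (by linarith) h3

/-- Uniform deviations of the empirical means of an increasing family of functions. -/
theorem measureReal_exists_deviation_le [DecidableEq ι] [LinearOrder κ] [Nonempty κ]
    (hgm : ∀ k, Measurable (g k)) (hg : Monotone g)
    (hg01 : ∀ k θ, g k θ ∈ Set.Icc (0 : ℝ) 1) (D : Measure T) [IsProbabilityMeasure D]
    {η : ℝ} (hη : 0 ≤ η) :
    (Measure.pi fun _ : ι => D).real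
        {S | ∃ k, Fintype.card ι * η ≤ ∑ i, (g k (S i) - ∫ θ, g k θ ∂D)} ≤
      4 * Real.exp (-(Fintype.card ι * η ^ 2 / 8)) := by
  set P := Measure.pi fun _ : ι => D
  -- Minimizes the Chernoff exponent `2 * b ^ 2 - b * η`, with value `-η ^ 2 / 8`.
  set b := η / 4 with hb
  have hint : Integrable (signedSup g b (1 : ι → ℤˣ)) (P.prod P) :=
    integrable_of_mem_Icc (measurable_signedSup hgm b 1) _ _ (signedSup_mem_Icc hg01 b 1)
  -- Each centred sum is the mean over the ghost sample of a signed sum, so Jensen bounds its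
  -- exponential by a quantity free of `k`, to which Markov's inequality applies.
  have hsub : {S | ∃ k, Fintype.card ι * η ≤ ∑ i, (g k (S i) - ∫ θ, g k θ ∂D)} ⊆
      {S | Real.exp (b * (Fintype.card ι * η)) ≤
        ∫ S', signedSup g b (1 : ι → ℤˣ) (S, S') ∂P} := by
    rintro S ⟨k, hk⟩
    have hgi : ∀ i, Integrable (fun S' : ι → T => g k (S' i)) P := fun i =>
      integrable_of_mem_Icc ((hgm k).comp (measurable_pi_apply i)) 0 1 fun S' => hg01 k _
    have hm : Measurable fun S' : ι → T =>
        b * ∑ i, ((((1 : ι → ℤˣ) i : ℤˣ) : ℤ) : ℝ) * (g k (S i) - g k (S' i)) :=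
      (measurable_signed_sum hgm b 1 k).comp measurable_prodMk_left
    have hmean : ∫ S', b * ∑ i, ((((1 : ι → ℤˣ) i : ℤˣ) : ℤ) : ℝ) * (g k (S i) - g k (S' i)) ∂P =
        b * ∑ i, (g k (S i) - ∫ θ, g k θ ∂D) := by
      rw [integral_const_mul]
      simp only [Pi.one_apply, Units.val_one, Int.cast_one, one_mul]
      rw [integral_finsetSum Finset.univ (f := fun i (S' : ι → T) => g k (S i) - g k (S' i))
        fun i _ => (integrable_const _).sub (hgi i)]
      congr 1
      refine Finset.sum_congr rfl fun i _ => ?_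
      rw [integral_sub (integrable_const _) (hgi i),
        integral_comp_eval (μ := fun _ : ι => D) (hgm k).aestronglyMeasurable]
      simp
    calc Real.exp (b * (Fintype.card ι * η))
        ≤ Real.exp (b * ∑ i, (g k (S i) - ∫ θ, g k θ ∂D)) := by gcongr
      _ ≤ ∫ S', Real.exp (b * ∑ i, ((((1 : ι → ℤˣ) i : ℤˣ) : ℤ) : ℝ) *
            (g k (S i) - g k (S' i))) ∂P := by
          rw [← hmean]
          exact exp_integral_le hm _ fun S' => abs_signed_sum_le hg01 b 1 (S, S') k
      _ ≤ _ := by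
          refine integral_mono ?_ ?_ fun S' => le_signedSup g b 1 (S, S') k
          · exact integrable_of_mem_Icc hm.exp 0 (Real.exp (|b| * Fintype.card ι)) fun S' =>
              ⟨(Real.exp_pos _).le, Real.exp_le_exp.mpr
                (abs_le.mp (abs_signed_sum_le hg01 b 1 (S, S') k)).2⟩
          · exact integrable_of_mem_Icc ((measurable_signedSup hgm b 1).comp measurable_prodMk_left)
              _ _ fun S' => signedSup_mem_Icc hg01 b 1 (S, S')
  have hmarkov := mul_meas_ge_le_integral_of_nonneg (μ := P)
    (f := fun S => ∫ S', signedSup g b (1 : ι → ℤˣ) (S, S') ∂P)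
    (Filter.Eventually.of_forall fun S => integral_nonneg fun S' =>
      (signedSup_mem_Icc hg01 b 1 (S, S')).1) hint.integral_prod_left
    (Real.exp (b * (Fintype.card ι * η)))
  rw [← integral_prod _ hint] at hmarkov
  have hle := hmarkov.trans (integral_signedSup_le hgm hg hg01 D b)
  have hexp : -(Fintype.card ι * η ^ 2 / 8) =
      Fintype.card ι * (2 * b ^ 2) - b * (Fintype.card ι * η) := by rw [hb]; ring
  rw [hexp, Real.exp_sub, ← mul_div_assoc, le_div_iff₀ (Real.exp_pos _), mul_comm]
  refine le_trans ?_ hle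
  gcongr
  finiteness

end Symmetrization

/-! ### The query algorithm and its grid. -/

section Algorithm

variable {m : ℕ} (r : Fin m → ℝ) (pick : List (ℝ × ℝ) → ℝ)

theorem output_queryAll (O : (Fin m → ℝ) → ℝ) (L : List ℝ) (record : List (ℝ × ℝ)) :
    (queryAll r pick L record).output O = pick (record ++ L.map fun α => (α, O (α • r))) := by
  induction L generalizing record with
  | nil => simp [queryAll, OracleAlg.output]
  | cons α L ih => simp [queryAll, OracleAlg.output, ih]

theorem queries_queryAll (O : (Fin m → ℝ) → ℝ) (L : List ℝ) (record : List (ℝ × ℝ)) :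
    (queryAll r pick L record).queries O = L.length := by
  induction L generalizing record with
  | nil => simp [queryAll, OracleAlg.queries]
  | cons α L ih => simp [queryAll, OracleAlg.queries, ih]

theorem one_mem_grid (ε : ℝ) : (1 : ℝ) ∈ grid ε := by simp [grid]

theorem zero_mem_grid (ε : ℝ) : (0 : ℝ) ∈ grid ε := by
  simp only [grid, List.mem_append, List.mem_map, List.mem_range]
  exact Or.inl ⟨0, by omega, by simp⟩

theorem queries_eum_le (O : (Fin m → ℝ) → ℝ) {ε : ℝ} (hε : 0 < ε) :
    ((eum r ε pick).queries O : ℝ) ≤ 4 / ε + 2 := by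
  rw [eum, queries_queryAll, grid]
  simp only [List.length_append, List.length_map, List.length_range, List.length_singleton]
  push_cast
  linarith [Nat.floor_le (div_nonneg (by norm_num : (0 : ℝ) ≤ 4) hε.le)]

theorem output_eum_spec (hpick : IsArgmaxRule pick) (O : (Fin m → ℝ) → ℝ) (ε : ℝ) :
    (eum r ε pick).output O ∈ grid ε ∧
      ∀ α ∈ grid ε, O (α • r) ≤ O ((eum r ε pick).output O • r) := by
  rw [eum, output_queryAll, List.nil_append]
  obtain ⟨v, hv, hmax⟩ := hpick ((grid ε).map fun α => (α, O (α • r)))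
    (List.map_eq_nil_iff.not.mpr (List.ne_nil_of_mem (one_mem_grid ε)))
  obtain ⟨α, hα, h⟩ := List.mem_map.mp hv
  simp only [Prod.mk.injEq] at h
  rw [← h.1]
  refine ⟨hα, fun β hβ => ?_⟩
  rw [h.2]
  exact hmax _ (List.mem_map.mpr ⟨β, hβ, rfl⟩)

theorem grid_subset_Icc {ε : ℝ} (hε : 0 < ε) {α : ℝ} (h : α ∈ grid ε) :
    α ∈ Set.Icc (0 : ℝ) 1 := by
  simp only [grid, List.mem_append, List.mem_map, List.mem_range, List.mem_singleton] at h
  rcases h with ⟨k, hk, rfl⟩ | rfl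
  · have hk' : (k : ℝ) ≤ 4 / ε := (Nat.le_floor_iff (by positivity)).mp (by omega)
    rw [le_div_iff₀ hε] at hk'
    exact ⟨by positivity, by linarith⟩
  · simp

theorem exists_mem_grid_ge {ε : ℝ} (hε : 0 < ε) {α : ℝ} (hα : α ∈ Set.Icc (0 : ℝ) 1) :
    ∃ β ∈ grid ε, α ≤ β ∧ β ≤ α + ε / 4 := by
  have h1 := Nat.le_ceil (α / (ε / 4))
  have h2 := Nat.ceil_lt_add_one (div_nonneg hα.1 (by positivity : 0 ≤ ε / 4))
  set k := ⌈α / (ε / 4)⌉₊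
  have h3 : α ≤ k * (ε / 4) := (div_le_iff₀ (by positivity)).mp h1
  have h4 : k * (ε / 4) ≤ α + ε / 4 := by
    have h := mul_le_mul_of_nonneg_right h2.le (by positivity : 0 ≤ ε / 4)
    rwa [add_mul, one_mul, div_mul_cancel₀ _ (by positivity)] at h
  by_cases hk : k * (ε / 4) ≤ 1
  · refine ⟨k * (ε / 4), ?_, h3, h4⟩
    simp only [grid, List.mem_append, List.mem_map, List.mem_range]
    refine Or.inl ⟨k, Nat.lt_succ_of_le (Nat.le_floor ?_), rfl⟩
    rw [le_div_iff₀ hε]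
    linarith
  -- Rounding up may overshoot `1`; the extra grid point `1` covers this case.
  · exact ⟨1, one_mem_grid ε, hα.2, by linarith⟩

end Algorithm

/-! ### Utilities under linear contracts. -/

section Utility

variable {n m : ℕ} [NeZero n]

theorem measurable_prod_apply (i : Fin n) (j : Fin m) :
    Measurable fun θ : AgentType n m => θ.prod i j :=
  (measurable_pi_apply j).comp ((measurable_pi_apply i).comp
    (measurable_fst.comp (comap_measurable fun θ : AgentType n m => (θ.prod, θ.cost))))

theorem measurable_cost_apply (i : Fin n) : Measurable fun θ : AgentType n m => θ.cost i :=
  (measurable_pi_apply i).comp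
    (measurable_snd.comp (comap_measurable fun θ : AgentType n m => (θ.prod, θ.cost)))

theorem measurable_agentUtility (t : Fin m → ℝ) (i : Fin n) :
    Measurable fun θ : AgentType n m => agentUtility θ t i :=
  (Finset.measurable_sum _ fun j _ => (measurable_prod_apply i j).mul_const _).sub
    (measurable_cost_apply i)

theorem measurable_actionPayoff (r t : Fin m → ℝ) (i : Fin n) :
    Measurable fun θ : AgentType n m => actionPayoff r θ t i :=
  Finset.measurable_sum _ fun j _ => (measurable_prod_apply i j).mul_const _

theorem chosenAction_spec (r : Fin m → ℝ) (θ : AgentType n m) (t : Fin m → ℝ) :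
    IsChosenAction r θ t (chosenAction r θ t) :=
  Classical.choose_spec (exists_isChosenAction r θ t)

/-- The chosen action comes from `Classical.choose`, so its measurability is avoided: by favorable
tie-breaking, the utility is at least `c` exactly when some best response pays at least `c`. -/
theorem measurable_principalUtility (r t : Fin m → ℝ) :
    Measurable fun θ : AgentType n m => principalUtility r θ t := by
  refine measurable_of_Ici fun c => ?_
  have h : (fun θ : AgentType n m => principalUtility r θ t) ⁻¹' Set.Ici c =
      ⋃ i, (⋂ k, {θ | agentUtility θ t k ≤ agentUtility θ t i}) ∩
        {θ | c ≤ actionPayoff r θ t i} := by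
    ext θ
    simp only [Set.mem_preimage, Set.mem_Ici, Set.mem_iUnion, Set.mem_inter_iff, Set.mem_iInter,
      Set.mem_ofPred_eq]
    have hs := chosenAction_spec r θ t
    exact ⟨fun h => ⟨_, hs.1, h⟩, fun ⟨i, hi, hc⟩ => hc.trans (hs.2 i hi)⟩
  rw [h]
  exact MeasurableSet.iUnion fun i => (MeasurableSet.iInter fun k =>
    measurableSet_le (measurable_agentUtility t k) (measurable_agentUtility t i)).inter
    (measurableSet_le measurable_const (measurable_actionPayoff r t i))

/-- The expected reward generated by the agent `θ` under the linear contract `α r`. -/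
noncomputable def linearReward (r : Fin m → ℝ) (α : ℝ) (θ : AgentType n m) : ℝ :=
  ∑ j, θ.prod (chosenAction r θ (α • r)) j * r j

theorem principalUtility_smul (r : Fin m → ℝ) (θ : AgentType n m) (α : ℝ) :
    principalUtility r θ (α • r) = (1 - α) * linearReward r α θ := by
  rw [principalUtility, actionPayoff, linearReward, Finset.mul_sum]
  refine Finset.sum_congr rfl fun j _ => ?_
  rw [Pi.smul_apply, smul_eq_mul]
  ring

theorem linearReward_mem_Icc {r : Fin m → ℝ} (hr : ∀ j, r j ∈ Set.Icc (0 : ℝ) 1) (α : ℝ)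
    (θ : AgentType n m) : linearReward r α θ ∈ Set.Icc (0 : ℝ) 1 := by
  refine ⟨Finset.sum_nonneg fun j _ => mul_nonneg (θ.prod_nonneg _ _) (hr j).1, ?_⟩
  rw [linearReward, ← θ.prod_sum (chosenAction r θ (α • r))]
  exact Finset.sum_le_sum fun j _ => mul_le_of_le_one_right (θ.prod_nonneg _ _) (hr j).2

/-- Adding the optimality inequalities of the two chosen actions cancels the costs and leaves `(β -
α)` times the change in reward, which is therefore nonnegative. -/
theorem linearReward_mono (r : Fin m → ℝ) (θ : AgentType n m) :
    Monotone fun α => linearReward r α θ := by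
  intro α β hαβ
  rcases hαβ.eq_or_lt with rfl | hlt
  · exact le_rfl
  have h1 := (chosenAction_spec r θ (α • r)).1 (chosenAction r θ (β • r))
  have h2 := (chosenAction_spec r θ (β • r)).1 (chosenAction r θ (α • r))
  have e : ∀ (γ : ℝ) i, agentUtility θ (γ • r) i = γ * ∑ j, θ.prod i j * r j - θ.cost i := by
    intro γ i
    rw [agentUtility, Finset.mul_sum]
    congr 1
    refine Finset.sum_congr rfl fun j _ => ?_
    rw [Pi.smul_apply, smul_eq_mul]
    ring
  rw [e, e] at h1 h2
  simp only [linearReward]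
  nlinarith

theorem measurable_linearReward (r : Fin m → ℝ) {α : ℝ} (hα : α < 1) :
    Measurable (linearReward r α : AgentType n m → ℝ) := by
  have h : (linearReward r α : AgentType n m → ℝ) =
      fun θ => principalUtility r θ (α • r) / (1 - α) := by
    ext θ
    rw [principalUtility_smul, mul_div_cancel_left₀ _ (sub_pos.mpr hα).ne']
  rw [h]
  exact (measurable_principalUtility r _).div_const _

theorem principalUtility_mem_Icc {r : Fin m → ℝ} (hr : ∀ j, r j ∈ Set.Icc (0 : ℝ) 1)
    {α : ℝ} (hα : α ∈ Set.Icc (0 : ℝ) 1) (θ : AgentType n m) :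
    principalUtility r θ (α • r) ∈ Set.Icc (0 : ℝ) 1 := by
  rw [principalUtility_smul]
  have h := linearReward_mem_Icc hr α θ
  exact ⟨mul_nonneg (sub_nonneg.mpr hα.2) h.1,
    mul_le_one₀ (by linarith [hα.1]) h.1 h.2⟩

/-- Raising the share does not lower the reward, and the extra share `β - α` is paid on a reward of
at most `1`. -/
theorem principalUtility_le_add {r : Fin m → ℝ} (hr : ∀ j, r j ∈ Set.Icc (0 : ℝ) 1)
    {α β : ℝ} (hαβ : α ≤ β) (hβ : β ≤ 1) (θ : AgentType n m) :
    principalUtility r θ (α • r) ≤ principalUtility r θ (β • r) + (β - α) := by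
  rw [principalUtility_smul, principalUtility_smul]
  have h := linearReward_mem_Icc hr α θ
  have h2 := linearReward_mono r θ hαβ
  simp only at h2
  nlinarith [mul_le_mul_of_nonneg_left h2 (sub_nonneg.mpr hβ),
    mul_le_mul_of_nonneg_left h.2 (sub_nonneg.mpr hαβ)]

variable {D : Measure (AgentType n m)} [IsProbabilityMeasure D]

theorem integrable_principalUtility {r : Fin m → ℝ} (hr : ∀ j, r j ∈ Set.Icc (0 : ℝ) 1)
    {α : ℝ} (hα : α ∈ Set.Icc (0 : ℝ) 1) :
    Integrable (fun θ => principalUtility r θ (α • r)) D :=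
  integrable_of_mem_Icc (measurable_principalUtility r _) 0 1 (principalUtility_mem_Icc hr hα)

theorem expectedUtility_le_one {r : Fin m → ℝ} (hr : ∀ j, r j ∈ Set.Icc (0 : ℝ) 1)
    {α : ℝ} (hα : α ∈ Set.Icc (0 : ℝ) 1) : expectedUtility r D (α • r) ≤ 1 := by
  have := integral_mono (integrable_principalUtility (D := D) hr hα) (integrable_const 1)
    fun θ => (principalUtility_mem_Icc hr hα θ).2
  simpa [expectedUtility] using this

theorem expectedUtility_le_add {r : Fin m → ℝ} (hr : ∀ j, r j ∈ Set.Icc (0 : ℝ) 1)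
    {α β : ℝ} (hα : α ∈ Set.Icc (0 : ℝ) 1) (hβ : β ∈ Set.Icc (0 : ℝ) 1) (hαβ : α ≤ β) :
    expectedUtility r D (α • r) ≤ expectedUtility r D (β • r) + (β - α) := by
  have hi := integrable_principalUtility (D := D) hr hβ
  have := integral_mono (integrable_principalUtility (D := D) hr hα)
    (hi.add (integrable_const (β - α))) (principalUtility_le_add hr hαβ hβ.2)
  rw [integral_add' hi (integrable_const _)] at this
  simpa [expectedUtility] using this

/-- With high probability, no grid point has an empirical utility exceeding its expected utility
by more than `η`. -/
theorem measureReal_exists_overestimate_le {r : Fin m → ℝ} (hr : ∀ j, r j ∈ Set.Icc (0 : ℝ) 1)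
    {s : ℕ} (hs : 0 < s) {ε : ℝ} (hε : 0 < ε) {η : ℝ} (hη : 0 < η) :
    (Measure.pi fun _ : Fin s => D).real
        {S | ∃ α ∈ grid ε, expectedUtility r D (α • r) + η ≤ empiricalUtility r S (α • r)} ≤
      4 * Real.exp (-(s * η ^ 2 / 8)) := by
  -- At `α = 1` the utility vanishes, so no deviation occurs there; for `α < 1`, measurability of
  -- the reward follows from dividing the utility by `1 - α`.
  let A : Finset ℝ := (grid ε).toFinset.filter (· < 1)
  have : Nonempty A := ⟨0, by simp [A, zero_mem_grid]⟩
  have h := measureReal_exists_deviation_le (ι := Fin s) (κ := A)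
    (g := fun α => linearReward r (α : ℝ))
    (fun α => measurable_linearReward r (Finset.mem_filter.mp α.2).2)
    (fun α β hαβ θ => linearReward_mono r θ hαβ)
    (fun α θ => linearReward_mem_Icc hr α θ) D hη.le
  rw [Fintype.card_fin] at h
  refine le_trans (measureReal_mono ?_) h
  rintro S ⟨α, hα, hdev⟩
  have hs' : (0 : ℝ) < s := by exact_mod_cast hs
  have hαI := grid_subset_Icc hε hα
  rw [expectedUtility, empiricalUtility] at hdev
  simp_rw [principalUtility_smul, ← Finset.mul_sum] at hdev
  rw [integral_const_mul] at hdev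
  set Y := ∑ i, linearReward r α (S i)
  set G := ∫ θ, linearReward r α θ ∂D
  have hdev' : η ≤ (1 - α) * (1 / s * Y - G) := by linarith
  have hα1 : α < 1 := lt_of_le_of_ne hαI.2 fun h => by
    rw [h] at hdev'
    linarith
  refine ⟨⟨α, by simp [A, hα, hα1]⟩, ?_⟩
  rw [Finset.sum_sub_distrib]
  simp only [Finset.sum_const, Finset.card_univ, Fintype.card_fin, nsmul_eq_mul]
  change s * η ≤ Y - s * G
  have hpos : 0 < 1 / s * Y - G :=
    (mul_pos_iff_of_pos_left (sub_pos.mpr hα1)).mp (hη.trans_le hdev')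
  -- The factor `1 - α` is at most `1`, so a utility deviation forces at least as large a reward
  -- deviation.
  have hle : η ≤ 1 / s * Y - G := hdev'.trans (mul_le_of_le_one_left hpos.le (by linarith [hαI.1]))
  have := mul_le_mul_of_nonneg_left hle hs'.le
  rwa [mul_sub, ← mul_assoc, mul_one_div_cancel hs'.ne', one_mul] at this

/-- With high probability, the empirical utility of a fixed contract does not fall short of its
expected utility by more than `η`. -/
theorem measureReal_underestimate_le {r : Fin m → ℝ} (hr : ∀ j, r j ∈ Set.Icc (0 : ℝ) 1)
    {s : ℕ} (hs : 0 < s) {α : ℝ} (hα : α ∈ Set.Icc (0 : ℝ) 1) {η : ℝ} (hη : 0 < η) :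
    (Measure.pi fun _ : Fin s => D).real
        {S | empiricalUtility r S (α • r) + η ≤ expectedUtility r D (α • r)} ≤
      4 * Real.exp (-(s * η ^ 2 / 8)) := by
  have h := measureReal_exists_deviation_le (ι := Fin s) (κ := Unit)
    -- A one-member family is trivially monotone, and the complement turns the upper tail into the
    -- lower one.
    (g := fun _ θ => 1 - principalUtility r θ (α • r))
    (fun _ => measurable_const.sub (measurable_principalUtility r _))
    (fun _ _ _ => le_rfl)
    (fun _ θ => by
      have := principalUtility_mem_Icc hr hα θ
      exact ⟨by linarith [this.2], by linarith [this.1]⟩) D hη.le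
  rw [Fintype.card_fin] at h
  refine le_trans (measureReal_mono ?_) h
  intro S hdev
  have hs' : (0 : ℝ) < s := by exact_mod_cast hs
  refine ⟨(), ?_⟩
  rw [integral_sub (integrable_const _) (integrable_principalUtility hr hα)]
  simp only [Set.mem_ofPred_eq, empiricalUtility, expectedUtility] at hdev
  simp only [integral_const, probReal_univ, smul_eq_mul, mul_one, sub_sub_sub_cancel_left,
    Finset.sum_sub_distrib, Finset.sum_const, Finset.card_univ, Fintype.card_fin, nsmul_eq_mul]
  have := mul_le_mul_of_nonneg_left hdev hs'.le
  rw [mul_add, ← mul_assoc, mul_one_div_cancel hs'.ne', one_mul] at this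
  linarith

/-- If no grid point is overestimated by `3ε/8` and the best grid point is not underestimated by
`3ε/8`, an empirical maximizer over the grid is optimal up to `ε`. -/
theorem sSup_sub_le_expectedUtility {r : Fin m → ℝ} (hr : ∀ j, r j ∈ Set.Icc (0 : ℝ) 1)
    {ε : ℝ} (hε : 0 < ε) {s : ℕ} {S : Fin s → AgentType n m} {α₀ α : ℝ}
    (hα₀ : α₀ ∈ grid ε)
    (hmax : ∀ β ∈ grid ε, expectedUtility r D (β • r) ≤ expectedUtility r D (α₀ • r))
    (hα : empiricalUtility r S (α₀ • r) ≤ empiricalUtility r S (α • r))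
    (hover : empiricalUtility r S (α • r) < expectedUtility r D (α • r) + 3 * ε / 8)
    (hunder : expectedUtility r D (α₀ • r) < empiricalUtility r S (α₀ • r) + 3 * ε / 8) :
    sSup (expectedUtility r D '' linearContracts r) - ε ≤ expectedUtility r D (α • r) := by
  rw [sub_le_iff_le_add]
  refine csSup_le (Set.Nonempty.image _ ⟨_, α₀, grid_subset_Icc hε hα₀, rfl⟩) ?_
  rintro _ ⟨_, ⟨β, hβ, rfl⟩, rfl⟩
  obtain ⟨γ, hγ, hβγ, hγβ⟩ := exists_mem_grid_ge hε hβ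
  have h1 := expectedUtility_le_add (D := D) hr hβ (grid_subset_Icc hε hγ) hβγ
  have h2 := hmax γ hγ
  linarith

end Utility

/-! ### Combining the failure probabilities. -/

/-- Monotonicity and subadditivity suffice, so the good event, which quantifies over all
tie-breaking rules, need not be measurable. -/
theorem one_sub_le_measureReal {Ω : Type*} [MeasurableSpace Ω] {P : Measure Ω}
    [IsProbabilityMeasure P] {A B C : Set Ω} (h : ∀ x, x ∉ B → x ∉ C → x ∈ A) :
    1 - (P.real B + P.real C) ≤ P.real A := by
  have hcover : Set.univ ⊆ A ∪ (B ∪ C) := by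
    intro x _
    by_contra hx
    simp only [Set.mem_union, not_or] at hx
    exact hx.1 (h x hx.2.1 hx.2.2)
  have h1 : P.real Set.univ ≤ P.real (A ∪ (B ∪ C)) := measureReal_mono hcover
  rw [probReal_univ] at h1
  linarith [measureReal_union_le (μ := P) A (B ∪ C), measureReal_union_le (μ := P) B C]

theorem eight_mul_exp_le {ε δ s : ℝ} (hε : 0 < ε) (hδ : δ ∈ Set.Ioo (0 : ℝ) 1)
    (hs : 6912 * Real.log (4 / δ) / ε ^ 2 ≤ s) :
    8 * Real.exp (-(s * (3 * ε / 8) ^ 2 / 8)) ≤ δ := by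
  have hδ0 := hδ.1
  rw [div_le_iff₀ (by positivity)] at hs
  have hL : 0 < Real.log (4 / δ) := Real.log_pos (by rw [lt_div_iff₀ hδ0]; linarith [hδ.2])
  -- Two logarithms suffice, as `8 * (δ / 4) ^ 2 = δ ^ 2 / 2 ≤ δ`; the constant `6912` leaves ample
  -- room.
  have h1 : -(s * (3 * ε / 8) ^ 2 / 8) ≤ -Real.log (4 / δ) + -Real.log (4 / δ) := by nlinarith
  have h2 := Real.exp_le_exp.mpr h1
  rw [Real.exp_add, Real.exp_neg (Real.log _), Real.exp_log (by positivity), inv_div] at h2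
  nlinarith [hδ.2]

end LinearContracts

theorem corollary2 {n m : ℕ} [NeZero n]
    (D : MeasureTheory.Measure (LinearContracts.AgentType n m))
    [MeasureTheory.IsProbabilityMeasure D]
    (r : Fin m → ℝ) (hr : ∀ j, r j ∈ Set.Icc (0 : ℝ) 1)
    (ε δ : ℝ) (hε : 0 < ε) (hδ : δ ∈ Set.Ioo (0 : ℝ) 1)
    (s : ℕ) (hs : 6912 * Real.log (4 / δ) / ε ^ 2 ≤ (s : ℝ)) :
    -- the expected utilities are genuine integrals and their supremum is a genuine supremum
    ((∀ t ∈ LinearContracts.linearContracts r,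
        MeasureTheory.Integrable (fun θ => LinearContracts.principalUtility r θ t) D) ∧
      BddAbove (LinearContracts.expectedUtility r D '' LinearContracts.linearContracts r)) ∧
    -- the algorithm, run on any sample, maximizes the empirical utility over the grid in `[0,1]`,
    -- and asks at most `4/ε + 2` queries, hence at most `6/ε` when `ε ≤ 1`
    (∀ pick, LinearContracts.IsArgmaxRule pick →
      ∀ S : Fin s → LinearContracts.AgentType n m,
        (LinearContracts.eum r ε pick).output (LinearContracts.empiricalUtility r S)
            ∈ LinearContracts.grid ε ∧
        (∀ α ∈ LinearContracts.grid ε, α ∈ Set.Icc (0 : ℝ) 1 ∧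
          LinearContracts.empiricalUtility r S (α • r) ≤
            LinearContracts.empiricalUtility r S
              ((LinearContracts.eum r ε pick).output (LinearContracts.empiricalUtility r S) • r)) ∧
        (((LinearContracts.eum r ε pick).queries (LinearContracts.empiricalUtility r S) : ℕ) : ℝ)
            ≤ 4 / ε + 2 ∧
        (ε ≤ 1 →
          (((LinearContracts.eum r ε pick).queries (LinearContracts.empiricalUtility r S) : ℕ) : ℝ)
            ≤ 6 / ε)) ∧
    -- with probability at least `1 - δ` over the sample, however ties are broken, the returned
    -- contract is linear and optimal up to `ε`
    1 - δ ≤ (MeasureTheory.Measure.pi (fun _ : Fin s => D)).real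
      {S | ∀ pick, LinearContracts.IsArgmaxRule pick →
        (LinearContracts.eum r ε pick).output (LinearContracts.empiricalUtility r S) • r
            ∈ LinearContracts.linearContracts r ∧
        sSup (LinearContracts.expectedUtility r D '' LinearContracts.linearContracts r) - ε ≤
          LinearContracts.expectedUtility r D
            ((LinearContracts.eum r ε pick).output (LinearContracts.empiricalUtility r S) • r)} := by
  have hδ0 : 0 < δ := hδ.1
  refine ⟨⟨?_, ?_⟩, fun pick hpick S => ?_, ?_⟩
  · rintro _ ⟨α, hα, rfl⟩
    exact LinearContracts.integrable_principalUtility hr hα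
  · refine ⟨1, ?_⟩
    rintro _ ⟨_, ⟨α, hα, rfl⟩, rfl⟩
    exact LinearContracts.expectedUtility_le_one hr hα
  · obtain ⟨hmem, hmax⟩ :=
      LinearContracts.output_eum_spec r pick hpick (LinearContracts.empiricalUtility r S) ε
    have hq := LinearContracts.queries_eum_le r pick (LinearContracts.empiricalUtility r S) hε
    refine ⟨hmem, fun α hα => ⟨LinearContracts.grid_subset_Icc hε hα, hmax α hα⟩, hq,
      fun hε1 => hq.trans ?_⟩
    rw [le_div_iff₀ hε, add_mul, div_mul_cancel₀ _ hε.ne']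
    linarith
  · have hs0 : 0 < s := by
      have hL : 0 < Real.log (4 / δ) := Real.log_pos (by rw [lt_div_iff₀ hδ0]; linarith [hδ.2])
      have : (0 : ℝ) < s := lt_of_lt_of_le (by positivity) hs
      exact_mod_cast this
    -- This comparator depends on `D` but not on the sample, so a lower-tail bound at a single
    -- contract is enough.
    obtain ⟨α₀, hα₀, hbest⟩ := Finset.exists_max_image (LinearContracts.grid ε).toFinset
      (fun α => LinearContracts.expectedUtility r D (α • r))
      ⟨1, List.mem_toFinset.mpr (LinearContracts.one_mem_grid ε)⟩
    rw [List.mem_toFinset] at hα₀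
    have hη : 0 < 3 * ε / 8 := by positivity
    have h1 := LinearContracts.measureReal_exists_overestimate_le (D := D) hr hs0 hε hη
    have h2 := LinearContracts.measureReal_underestimate_le (D := D) hr hs0
      (LinearContracts.grid_subset_Icc hε hα₀) hη
    have h3 := LinearContracts.eight_mul_exp_le hε hδ hs
    refine le_trans ?_ (LinearContracts.one_sub_le_measureReal (P := MeasureTheory.Measure.pi fun _ => D)
      (B := {S | ∃ α ∈ LinearContracts.grid ε,
        LinearContracts.expectedUtility r D (α • r) + 3 * ε / 8 ≤
          LinearContracts.empiricalUtility r S (α • r)})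
      (C := {S | LinearContracts.empiricalUtility r S (α₀ • r) + 3 * ε / 8 ≤
        LinearContracts.expectedUtility r D (α₀ • r)}) fun S hB hC pick hpick => ?_)
    · linarith
    · obtain ⟨hmem, hmax⟩ :=
        LinearContracts.output_eum_spec r pick hpick (LinearContracts.empiricalUtility r S) ε
      exact ⟨⟨_, LinearContracts.grid_subset_Icc hε hmem, rfl⟩,
        LinearContracts.sSup_sub_le_expectedUtility hr hε hα₀
          (fun β hβ => hbest β (List.mem_toFinset.mpr hβ)) (hmax α₀ hα₀)
          (lt_of_not_ge fun h => hB ⟨_, hmem, h⟩) (lt_of_not_ge hC)⟩
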